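/- **Setting.** Let $\mathbb T$ be the countable set of finite unlabeled rooted trees (finite rooted trees up to root-preserving graph isomorphism) and $\mathbb T_*=\mathbb T\sqcup\{*\}$, both with the discrete topology; $\mathbb T^\infty$ and $\mathbb T_*^\infty$ carry the product topology. For $\mathbf t\in\mathbb T$ with root $\rho$ and a vertex $v$ of $\mathbf t$, let $v=v_0,v_1,\dots,v_h=\rho$ be the path from $v$ to $\rho$; let $t_0$ be the subtree rooted at $v_0$ of all vertices whose path to the root passes through $v_0$, and for $1\le k\le h$ let $t_k$ be the subtree rooted at $v_k$ of all vertices whose path to the root passes through $v_k$ but not through $v_{k-1}$. Let $\Phi(\mathbf t,\cdot)$ be the law of $(t_0,\dots,t_h,*,*,\dots)\in\mathbb T_*^\infty$ when $v$ is a uniformly chosen vertex of $\mathbf t$. Random trees $\mathcal T_n\in\mathbb T$ *converge in the probability fringe sense* to a $\mathbb T^\infty$-valued random variable $\mathcal T=(\mathcal T^0,\mathcal T^1,\dots)$ if the random probability measures $\Phi(\mathcal T_n,\cdot)$ converge in distribution, in the space of probability measures on $\mathbb T_*^\infty$ with the topology of weak convergence, to the (deterministic) distribution of $\mathcal T$.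 An element $(t_0,t_1,\dots)$ of $\mathbb T^\infty$ is identified with the infinite tree (sin-tree) obtained from the disjoint union of the $t_k$ by joining the root of $t_k$ to the root of $t_{k+1}$ for every $k\ge0$. For a forest $\mathbf f$ put $\mathbf f_0=\mathbf f$, and let $\mathbf f_{k+1}$ be obtained from $\mathbf f_k$, with the same vertices, by removing every edge that has an endpoint adjacent in $\mathbf f_k$ to a leaf (a vertex of degree one) of $\mathbf f_k$. Let $L_k(\mathbf f)$ and $I_k(\mathbf f)$ be the sets of leaves and of isolated vertices of $\mathbf f_k$, and let $$G_k(\mathbf f)=\{u\in L_k(\mathbf f): u \text{ is adjacent in } \mathbf f_k \text{ to some } v\in L_k(\mathbf f)\},$$ $$H_k(\mathbf f)=\{u\notin L_k(\mathbf f): u \text{ is adjacent in } \mathbf f_k \text{ to some } v\in L_k(\mathbf f)\},$$ $$J_k(\mathbf f)=\bigl(I_{k+1}(\mathbf f)\setminus I_k(\mathbf f)\bigr)\setminus\bigl(G_k(\mathbf f)\cup H_k(\mathbf f)\bigr).$$ **Proposition 6.4.** Let $(\mathcal T_n)_{n\ge1}$ be a sequence of random finite unlabeled rooted trees that converges in the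 probability fringe sense to a random sin-tree $\mathcal T=(\mathcal T^0,\mathcal T^1,\dots)$. Let $F_n$ be the spectral distribution of $\mathcal T_n$, that is, the empirical distribution of the eigenvalues (with multiplicity) of its adjacency matrix, and let $R$ be the root of $\mathcal T^0$. Then $F_n(\{0\})$ converges in distribution as $n\to\infty$ to the constant $$\sum_{k=0}^\infty\Bigl(\mathbb P\{R\in J_k(\mathcal T)\}-\mathbb P\{R\in H_k(\mathcal T)\}\Bigr),$$ where the series converges absolutely. -/

import Mathlib

open MeasureTheory ProbabilityTheory Filter Topology
open scoped ENNReal BoundedContinuousFunction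

noncomputable section

namespace FringeTrees

/-! ### Finite rooted trees, labeled and unlabeled -/

/-- A finite rooted tree (as a graph) with vertex set `Fin size`. -/
structure LTree where
  /-- the number of vertices -/
  size : ℕ
  /-- the underlying graph -/
  graph : SimpleGraph (Fin size)
  isTree : graph.IsTree
  /-- the root -/
  root : Fin size

/-- Two finite rooted trees are the same if some graph isomorphism between them preserves the
root. -/
instance LTree.setoid : Setoid LTree where
  r s t := ∃ e : s.graph ≃g t.graph, e s.root = t.root
  iseqv :=
    { refl := fun _ => ⟨SimpleGraph.Iso.refl, rfl⟩
      symm := fun ⟨e, he⟩ => ⟨e.symm, by rw [← he]; exact e.symm_apply_apply _⟩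
      trans := fun ⟨e, he⟩ ⟨f, hf⟩ => ⟨f.comp e, by
        rw [← hf, ← he]; rfl⟩ }

/-- The set of finite unlabeled rooted trees. -/
def UTree : Type := Quotient LTree.setoid

instance : Countable LTree := by
  let f : LTree → Σ n : ℕ, SimpleGraph (Fin n) × Fin n := fun t => ⟨t.size, t.graph, t.root⟩
  have hf : Function.Injective f := by
    rintro ⟨n, G, hG, r⟩ ⟨n', G', hG', r'⟩ h
    simp only [f, Sigma.mk.injEq] at h
    obtain ⟨rfl, h⟩ := h
    simp only [heq_eq_eq, Prod.mk.injEq] at h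
    obtain ⟨rfl, rfl⟩ := h
    rfl
  exact hf.countable

instance : Countable UTree := inferInstanceAs (Countable (Quotient LTree.setoid))

instance : TopologicalSpace UTree := ⊥
instance : DiscreteTopology UTree := ⟨rfl⟩
instance : MeasurableSpace UTree := ⊤
instance : DiscreteMeasurableSpace UTree := ⟨fun _ => trivial⟩

/-- The set of finite unlabeled rooted trees with an adjoined point `none`, with the discrete
topology. -/
abbrev UTreeStar : Type := Option UTree

instance : TopologicalSpace UTreeStar := ⊥
instance : DiscreteTopology UTreeStar := ⟨rfl⟩
instance : MeasurableSpace UTreeStar := ⊤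
instance : DiscreteMeasurableSpace UTreeStar := ⟨fun _ => trivial⟩

/-- The unlabeled rooted tree given by a tree on an arbitrary finite vertex set. -/
def UTree.ofGraph {V : Type} [Fintype V] (G : SimpleGraph V) (hG : G.IsTree) (r : V) : UTree :=
  Quotient.mk LTree.setoid
    { size := Fintype.card V
      graph := G.comap (Fintype.equivFin V).symm
      isTree := (SimpleGraph.Iso.comap (Fintype.equivFin V).symm G).isTree_iff.2 hG
      root := Fintype.equivFin V r }

/-! ### The decomposition of a rooted tree along the path from a vertex to the root -/

namespace LTree

variable (t : LTree)

/-- The unique path from `v` to the root. -/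
def pathToRoot (v : Fin t.size) : t.graph.Walk v t.root :=
  (t.isTree.existsUnique_path v t.root).choose

lemma isPath_pathToRoot (v : Fin t.size) : (t.pathToRoot v).IsPath :=
  (t.isTree.existsUnique_path v t.root).choose_spec.1

lemma eq_pathToRoot {v : Fin t.size} (p : t.graph.Walk v t.root) (hp : p.IsPath) :
    p = t.pathToRoot v :=
  (t.isTree.existsUnique_path v t.root).unique hp (t.isPath_pathToRoot v)

/-- The distance from `v` to the root. -/
def height (v : Fin t.size) : ℕ := (t.pathToRoot v).length

/-- The `k`-th vertex `v_k` on the path `v = v_0, v_1, …, v_h` from `v` to the root. -/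
def ancestor (v : Fin t.size) (k : ℕ) : Fin t.size := (t.pathToRoot v).getVert k

/-- The vertex set of the `k`-th tree in the decomposition of `t` along the path
`v = v_0, v_1, …, v_h` from `v` to the root: for `k = 0`, all vertices whose path to the root
passes through `v_0`, and for `k ≥ 1`, all vertices whose path to the root passes through `v_k`
but not through `v_(k-1)`. -/
def fringeSet (v : Fin t.size) : ℕ → Set (Fin t.size)
  | 0 => {w | t.ancestor v 0 ∈ (t.pathToRoot w).support}
  | k + 1 => {w | t.ancestor v (k + 1) ∈ (t.pathToRoot w).support ∧
      t.ancestor v k ∉ (t.pathToRoot w).support}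

lemma dropUntil_pathToRoot {w x : Fin t.size} (hx : x ∈ (t.pathToRoot w).support) :
    (t.pathToRoot w).dropUntil x hx = t.pathToRoot x :=
  t.eq_pathToRoot _ ((t.isPath_pathToRoot w).dropUntil hx)

lemma ancestor_mem_fringeSet (v : Fin t.size) (k : ℕ) (hk : k ≤ t.height v) :
    t.ancestor v k ∈ t.fringeSet v k := by
  cases k with
  | zero => exact SimpleGraph.Walk.start_mem_support _
  | succ k =>
    refine ⟨SimpleGraph.Walk.start_mem_support _, fun hmem => ?_⟩
    have hdrop : (t.pathToRoot v).drop (k + 1) = t.pathToRoot (t.ancestor v (k + 1)) :=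
      t.eq_pathToRoot _ ((t.isPath_pathToRoot v).drop _)
    rw [← hdrop] at hmem
    replace hmem := SimpleGraph.Walk.mem_support_iff_exists_getVert.1 hmem
    obtain ⟨j, hj, hjl⟩ := hmem
    replace hj := (SimpleGraph.Walk.drop_getVert _ _ _).symm.trans hj
    replace hjl := hjl.trans_eq (SimpleGraph.Walk.drop_length _ _)
    have hk' : k + 1 ≤ (t.pathToRoot v).length := hk
    have := (t.isPath_pathToRoot v).getVert_injOn (x₁ := k + 1 + j) (x₂ := k)
      (by simp only [Set.mem_ofPred_eq]; omega) (by simp only [Set.mem_ofPred_eq]; omega) hj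
    omega

lemma fringeSet_isTree (v : Fin t.size) (k : ℕ) (hk : k ≤ t.height v) :
    (t.graph.induce (t.fringeSet v k)).IsTree := by
  have key : ∀ w ∈ t.fringeSet v k, ∃ h : t.ancestor v k ∈ (t.pathToRoot w).support,
      ∀ x ∈ ((t.pathToRoot w).takeUntil _ h).support, x ∈ t.fringeSet v k := by
    intro w hw
    have h : t.ancestor v k ∈ (t.pathToRoot w).support := by
      cases k with
      | zero => exact hw
      | succ k => exact hw.1
    refine ⟨h, fun x hx => ?_⟩
    have hxw : x ∈ (t.pathToRoot w).support := SimpleGraph.Walk.support_takeUntil_subset_support _ h hx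
    have hsub : ∀ y ∈ (t.pathToRoot x).support, y ∈ (t.pathToRoot w).support := by
      intro y hy
      rw [← t.dropUntil_pathToRoot hxw] at hy
      exact SimpleGraph.Walk.support_dropUntil_subset_support _ _ hy
    have hmem : t.ancestor v k ∈ (t.pathToRoot x).support := by
      have e : (((t.pathToRoot w).takeUntil _ h).dropUntil x hx).append
          ((t.pathToRoot w).dropUntil _ h) = t.pathToRoot x := by
        apply t.eq_pathToRoot
        have hp := t.isPath_pathToRoot w
        rw [← SimpleGraph.Walk.take_spec (t.pathToRoot w) h,
          ← SimpleGraph.Walk.take_spec ((t.pathToRoot w).takeUntil _ h) hx,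
          ← SimpleGraph.Walk.append_assoc] at hp
        exact hp.of_append_right
      rw [← e, SimpleGraph.Walk.mem_support_append_iff]
      exact Or.inl (SimpleGraph.Walk.end_mem_support _)
    cases k with
    | zero => exact hmem
    | succ k => exact ⟨hmem, fun h' => hw.2 (hsub _ h')⟩
  refine ⟨?_, t.isTree.isAcyclic.induce _⟩
  rw [SimpleGraph.connected_iff_exists_forall_reachable]
  refine ⟨⟨t.ancestor v k, t.ancestor_mem_fringeSet v k hk⟩, fun ⟨w, hw⟩ => ?_⟩
  obtain ⟨h, hx⟩ := key w hw
  exact (((t.pathToRoot w).takeUntil _ h).induce (t.fringeSet v k) hx).reachable.symm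

open scoped Classical in
/-- The sequence `(t_0, t_1, …, t_h, *, *, …)` attached to the vertex `v` of `t`, where `t_k` is
rooted at `v_k`. -/
def fringe (v : Fin t.size) (k : ℕ) : UTreeStar :=
  if hk : k ≤ t.height v then
    some (UTree.ofGraph (t.graph.induce (t.fringeSet v k)) (t.fringeSet_isTree v k hk)
      ⟨t.ancestor v k, t.ancestor_mem_fringeSet v k hk⟩)
  else none

lemma size_ne_zero : t.size ≠ 0 := fun h => (h ▸ t.root : Fin 0).elim0

/-- The law of the sequence attached to a uniformly chosen vertex of `t`. -/
def fringeLaw : ProbabilityMeasure (ℕ → UTreeStar) :=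
  ⟨(t.size : ℝ≥0∞)⁻¹ • ∑ v : Fin t.size, Measure.dirac (t.fringe v), ⟨by
    simp only [Measure.smul_apply, Measure.finsetSum_apply, measure_univ, Finset.sum_const,
      Finset.card_univ, Fintype.card_fin, nsmul_eq_mul, mul_one, smul_eq_mul]
    exact ENNReal.inv_mul_cancel (by exact_mod_cast t.size_ne_zero) (ENNReal.natCast_ne_top _)⟩⟩

open scoped Classical in
/-- The spectral distribution of `t`: the empirical distribution of the eigenvalues, with
multiplicity, of its adjacency matrix. -/
def spectralDistribution : Measure ℝ :=
  (t.size : ℝ≥0∞)⁻¹ •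
    ∑ i : Fin t.size, Measure.dirac ((t.graph.isHermitian_adjMatrix ℝ).eigenvalues i)

end LTree

namespace UTree

/-- A labeled representative of an unlabeled rooted tree. The notions below that are defined
through it do not depend on its choice (up to isomorphism). -/
def rep (t : UTree) : LTree := Quotient.out t

/-- The probability kernel `Φ` from finite unlabeled rooted trees to sequences. -/
def fringeLaw (t : UTree) : ProbabilityMeasure (ℕ → UTreeStar) := t.rep.fringeLaw

/-- The spectral distribution of an unlabeled rooted tree. -/
def spectralDistribution (t : UTree) : Measure ℝ := t.rep.spectralDistribution

end UTree

/-! ### Probability fringe convergence -/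

section Convergence

universe u v

variable {Ω : ℕ → Type u} [∀ n, MeasurableSpace (Ω n)] {Ω' : Type v} [MeasurableSpace Ω']

/-- The distribution of a random element of `UTree^∞`, as a law on `UTreeStar^∞`. -/
def sinTreeLaw (P : Measure Ω') [IsProbabilityMeasure P] {τ : Ω' → ℕ → UTree}
    (hτ : Measurable τ) : ProbabilityMeasure (ℕ → UTreeStar) :=
  ⟨P.map fun ω k => some (τ ω k), Measure.isProbabilityMeasure_map
    (measurable_pi_lambda _ fun k =>
      (Measurable.of_discrete (f := (some : UTree → UTreeStar))).comp
        ((measurable_pi_apply k).comp hτ)).aemeasurable⟩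

/-- Convergence of `T n` to `τ` in the probability fringe sense: the random probability measures
`Φ(T n, ·)` converge in distribution, as random elements of the space of probability measures on
`UTreeStar^∞` with the topology of weak convergence, to the (deterministic) distribution of `τ`.
The `T n` may live on different probability spaces. -/
def FringeConverges (μ : ∀ n, Measure (Ω n)) (T : ∀ n, Ω n → UTree)
    (P : Measure Ω') [IsProbabilityMeasure P] {τ : Ω' → ℕ → UTree} (hτ : Measurable τ) : Prop :=
  ∀ g : ProbabilityMeasure (ℕ → UTreeStar) →ᵇ ℝ,
    Tendsto (fun n => ∫ ω, g (T n ω).fringeLaw ∂(μ n)) atTop (𝓝 (g (sinTreeLaw P hτ)))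

end Convergence

/-! ### The tree with one infinite path built from a sequence of finite rooted trees -/

/-- The vertices of the infinite tree given by `τ`. -/
abbrev SinVertex (τ : ℕ → UTree) : Type := Σ k : ℕ, Fin (τ k).rep.size

/-- The infinite tree given by `τ`: the disjoint union of the trees `τ 0, τ 1, …` together with
the edges joining the root of `τ k` to the root of `τ (k + 1)`, for all `k`. -/
def sinTree (τ : ℕ → UTree) : SimpleGraph (SinVertex τ) :=
  SimpleGraph.fromRel fun x y =>
    (∃ (k : ℕ) (a b : Fin (τ k).rep.size), (τ k).rep.graph.Adj a b ∧ x = ⟨k, a⟩ ∧ y = ⟨k, b⟩) ∨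
    ∃ k : ℕ, x = ⟨k, (τ k).rep.root⟩ ∧ y = ⟨k + 1, (τ (k + 1)).rep.root⟩

/-- The root of `τ 0`, as a vertex of the infinite tree. -/
def sinRoot (τ : ℕ → UTree) : SinVertex τ := ⟨0, (τ 0).rep.root⟩

/-! ### The vertex classes of the leaf-removal algorithm -/

namespace KarpSipser

variable {V : Type*} (f : SimpleGraph V)

/-- A leaf is a vertex of degree one. -/
def IsLeaf (v : V) : Prop := ∃! w, f.Adj v w

/-- One round of leaf removal: every edge with an endpoint `y` adjacent to a leaf is removed. -/
def pruneRound : SimpleGraph V where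
  Adj u v := f.Adj u v ∧ (¬ ∃ x, IsLeaf f x ∧ f.Adj x u) ∧ ¬ ∃ x, IsLeaf f x ∧ f.Adj x v
  symm := ⟨fun _ _ h => ⟨h.1.symm, h.2.2, h.2.1⟩⟩
  loopless := ⟨fun _ h => f.irrefl h.1⟩

/-- The forest `f_k` remaining after `k` rounds. -/
def forestAfter : ℕ → SimpleGraph V
  | 0 => f
  | k + 1 => pruneRound (forestAfter k)

/-- `L_k(f)`: the leaves of `f_k`. -/
def L (k : ℕ) : Set V := {v | IsLeaf (forestAfter f k) v}

/-- `I_k(f)`: the isolated vertices of `f_k`. -/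
def I (k : ℕ) : Set V := {v | (forestAfter f k).IsIsolated v}

/-- `G_k(f)`: the leaves of `f_k` adjacent in `f_k` to a leaf. -/
def G (k : ℕ) : Set V := {u | u ∈ L f k ∧ ∃ v ∈ L f k, (forestAfter f k).Adj u v}

/-- `H_k(f)`: the vertices that are not leaves of `f_k` but adjacent in `f_k` to a leaf. -/
def H (k : ℕ) : Set V := {u | u ∉ L f k ∧ ∃ v ∈ L f k, (forestAfter f k).Adj u v}

/-- `J_k(f)`: the other vertices that become isolated in round `k + 1`. -/
def J (k : ℕ) : Set V := (I f (k + 1) \ I f k) \ (G f k ∪ H f k)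

end KarpSipser

end FringeTrees

end

open FringeTrees

/-! The mass at zero of the spectral distribution is the nullity of the adjacency matrix divided by
the number of vertices, and leaf removal computes this nullity up to a small error. Put N =
`nearLeaf` of f_k, which is the union of G_k and H_k. A null vector vanishes on N, because the
equation at a leaf says so. Hence the null space of f_k lies in that of f_(k+1), cut out by the
values on N and the equations at H_k. These forms are independent, so one round raises the nullity
by |N| + |H_k| (`finrank_nullSpace_pruneRound`). It raises the number of isolated vertices by |N| +
|J_k| (`ncard_I_succ`). Telescoping the difference leaves the sum of |J_k| - |H_k| over k < m, plus
|I_0|, plus a remainder between 0 and the number of vertices not isolated in f_m.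

In a tree, a vertex whose subtree has at most m vertices is isolated in f_m
(`LTree.mem_I_of_ncard_fringeSet_le`), so the remainder is controlled by the size of t_0. Membership
in J_k or H_k depends only on the neighborhood of radius 2k + 3, which the fringe sequence
determines when the vertex is at height at least 2k + 3 (`LTree.exists_localIso_fringe`). Thus both
the approximating sum and the error bound are combinations of fringe probabilities of events
depending on finitely many coordinates (`LTree.abs_real_spectralDistribution_zero_sub_le`).

Such events are clopen, so their probabilities are weakly continuous. Hence |F_n({0}) - c| is
dominated by a bounded continuous functional of the fringe law. Its value at the limit law tends to
0 as m grows: a sin-tree sequence contains no adjoined point, its first tree is finite, and the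
series converges. This gives L¹ convergence to c, hence convergence in distribution. -/

namespace FringeTrees

namespace KarpSipser

/-! ### Locality of leaf removal. -/

section LocalIso

variable {V V' : Type*} (f : SimpleGraph V) (f' : SimpleGraph V') (φ : V → V')

/-- The map `φ` is bijective on the neighborhoods of all vertices at distance less than `r`
from `x`. -/
def LocalIso : ℕ → V → Prop
  | 0, _ => True
  | r + 1, x => Set.BijOn φ (f.neighborSet x) (f'.neighborSet (φ x)) ∧
      ∀ y, f.Adj x y → LocalIso r y

/-- The vertices adjacent to a leaf. -/
def nearLeaf : Set V := {u | ∃ x, IsLeaf f x ∧ f.Adj x u}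

lemma pruneRound_adj {u v : V} :
    (pruneRound f).Adj u v ↔ f.Adj u v ∧ u ∉ nearLeaf f ∧ v ∉ nearLeaf f := Iff.rfl

lemma pruneRound_le : pruneRound f ≤ f := fun _ _ h => h.1

lemma forestAfter_le (k : ℕ) : forestAfter f k ≤ f := by
  induction k with
  | zero => exact le_rfl
  | succ k ih => exact (pruneRound_le _).trans ih

variable {f f' φ}

lemma LocalIso.of_succ {r : ℕ} {x : V} (h : LocalIso f f' φ (r + 1) x) : LocalIso f f' φ r x := by
  induction r generalizing x with
  | zero => trivial
  | succ r ih => exact ⟨h.1, fun y hy => ih (h.2 y hy)⟩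

lemma LocalIso.mono {r s : ℕ} (hrs : r ≤ s) {x : V} (h : LocalIso f f' φ s x) :
    LocalIso f f' φ r x := by
  induction s, hrs using Nat.le_induction with
  | base => exact h
  | succ s _ ih => exact ih h.of_succ

lemma isLeaf_iff_of_bijOn {x : V}
    (h : Set.BijOn φ (f.neighborSet x) (f'.neighborSet (φ x))) :
    IsLeaf f x ↔ IsLeaf f' (φ x) := by
  constructor
  · rintro ⟨w, hw, hu⟩
    refine ⟨φ w, h.mapsTo hw, fun y hy => ?_⟩
    obtain ⟨z, hz, rfl⟩ := h.surjOn hy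
    rw [hu z hz]
  · rintro ⟨w, hw, hu⟩
    obtain ⟨z, hz, rfl⟩ := h.surjOn hw
    exact ⟨z, hz, fun y hy => h.injOn hy hz (hu _ (h.mapsTo hy))⟩

lemma isIsolated_iff_of_bijOn {x : V}
    (h : Set.BijOn φ (f.neighborSet x) (f'.neighborSet (φ x))) :
    f.IsIsolated x ↔ f'.IsIsolated (φ x) := by
  constructor
  · intro hx y hy
    obtain ⟨z, hz, rfl⟩ := h.surjOn hy
    exact hx z hz
  · exact fun hx y hy => hx _ (h.mapsTo hy)

lemma mem_nearLeaf_iff_of_bijOn {x : V}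
    (h : Set.BijOn φ (f.neighborSet x) (f'.neighborSet (φ x)))
    (h' : ∀ y, f.Adj x y → Set.BijOn φ (f.neighborSet y) (f'.neighborSet (φ y))) :
    x ∈ nearLeaf f ↔ φ x ∈ nearLeaf f' := by
  constructor
  · rintro ⟨y, hy, hyx⟩
    exact ⟨φ y, (isLeaf_iff_of_bijOn (h' y hyx.symm)).1 hy, (h.mapsTo hyx.symm).symm⟩
  · rintro ⟨y, hy, hyx⟩
    obtain ⟨z, hz, rfl⟩ := h.surjOn hyx.symm
    exact ⟨z, (isLeaf_iff_of_bijOn (h' z hz)).2 hy, hz.symm⟩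

/-- Each round costs radius two: whether an edge at x survives depends on whether its other end y is
near a leaf, hence on the degrees of neighbors of y. -/
lemma bijOn_forestAfter (k : ℕ) {x : V} (h : LocalIso f f' φ (2 * k + 1) x) :
    Set.BijOn φ ((forestAfter f k).neighborSet x) ((forestAfter f' k).neighborSet (φ x)) := by
  induction k generalizing x with
  | zero => exact h.1
  | succ k ih =>
    have h0 := ih (h.mono (by omega))
    have h1 : ∀ y, f.Adj x y → LocalIso f f' φ (2 * k + 2) y := h.2
    have hx : x ∈ nearLeaf (forestAfter f k) ↔ φ x ∈ nearLeaf (forestAfter f' k) :=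
      mem_nearLeaf_iff_of_bijOn h0 fun y hy =>
        ih ((h1 y (forestAfter_le f k hy)).mono (by omega))
    have hy : ∀ y, (forestAfter f k).Adj x y →
        (y ∈ nearLeaf (forestAfter f k) ↔ φ y ∈ nearLeaf (forestAfter f' k)) := fun y hy =>
      mem_nearLeaf_iff_of_bijOn (ih ((h1 y (forestAfter_le f k hy)).mono (by omega)))
        fun z hz => ih ((h1 y (forestAfter_le f k hy)).2 z (forestAfter_le f k hz))
    refine ⟨fun y hxy => ?_, fun y hxy z hxz => h0.injOn hxy.1 hxz.1, fun y hxy => ?_⟩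
    · exact ⟨h0.mapsTo hxy.1, fun hn => hxy.2.1 (hx.2 hn), fun hn => hxy.2.2 ((hy y hxy.1).2 hn)⟩
    · obtain ⟨z, hz, rfl⟩ := h0.surjOn hxy.1
      exact ⟨z, ⟨hz, fun hn => hxy.2.1 (hx.1 hn), fun hn => hxy.2.2 ((hy z hz).1 hn)⟩, rfl⟩

variable (f) in
lemma mem_G_union_H_iff (k : ℕ) {x : V} :
    x ∈ G f k ∪ H f k ↔ x ∈ nearLeaf (forestAfter f k) := by
  constructor
  · rintro (⟨_, v, hv, h⟩ | ⟨_, v, hv, h⟩) <;> exact ⟨v, hv, h.symm⟩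
  · rintro ⟨v, hv, h⟩
    by_cases hx : x ∈ L f k
    · exact Or.inl ⟨hx, v, hv, h.symm⟩
    · exact Or.inr ⟨hx, v, hv, h.symm⟩

variable (f) in
lemma H_eq (k : ℕ) : H f k = nearLeaf (forestAfter f k) \ L f k := by
  ext x
  rw [Set.mem_sdiff, ← mem_G_union_H_iff]
  exact ⟨fun h => ⟨Or.inr h, h.1⟩, fun h => h.1.resolve_left fun h' => h.2 h'.1⟩

lemma mem_nearLeaf_forestAfter_iff (k : ℕ) {x : V} (h : LocalIso f f' φ (2 * k + 2) x) :
    x ∈ nearLeaf (forestAfter f k) ↔ φ x ∈ nearLeaf (forestAfter f' k) :=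
  mem_nearLeaf_iff_of_bijOn (bijOn_forestAfter k (h.mono (by omega)))
    fun y hy => bijOn_forestAfter k (h.2 y (forestAfter_le f k hy))

lemma mem_H_iff_of_localIso (k : ℕ) {x : V} (h : LocalIso f f' φ (2 * k + 3) x) :
    x ∈ H f k ↔ φ x ∈ H f' k := by
  rw [H_eq, H_eq, Set.mem_sdiff, Set.mem_sdiff,
    mem_nearLeaf_forestAfter_iff k (h.mono (by omega))]
  exact and_congr_right fun _ =>
    not_congr (isLeaf_iff_of_bijOn (bijOn_forestAfter k (h.mono (by omega))))

lemma mem_I_iff_of_localIso (k : ℕ) {x : V} (h : LocalIso f f' φ (2 * k + 1) x) :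
    x ∈ I f k ↔ φ x ∈ I f' k :=
  isIsolated_iff_of_bijOn (bijOn_forestAfter k h)

/-- The radius is dictated by `I f (k + 1)`, which needs 2(k + 1) + 1. -/
lemma mem_J_iff_of_localIso (k : ℕ) {x : V} (h : LocalIso f f' φ (2 * k + 3) x) :
    x ∈ J f k ↔ φ x ∈ J f' k := by
  simp only [J, Set.mem_sdiff, mem_G_union_H_iff]
  rw [mem_nearLeaf_forestAfter_iff k (h.mono (by omega)),
    mem_I_iff_of_localIso k (h.mono (by omega)), mem_I_iff_of_localIso (k + 1) h]

end LocalIso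

/-! ### Vertices isolated in each round. -/

section Partition

variable {V : Type*} (f : SimpleGraph V)

lemma isIsolated_pruneRound_of_mem_nearLeaf {u : V} (h : u ∈ nearLeaf f) :
    (pruneRound f).IsIsolated u := fun _ hw => hw.2.1 h

lemma isIsolated_pruneRound_of_isLeaf {u : V} (h : IsLeaf f u) :
    (pruneRound f).IsIsolated u := fun _ hw => hw.2.2 ⟨u, h, hw.1⟩

lemma I_mono : Monotone (I f) :=
  monotone_nat_of_le_succ fun _ _ hv w hw => hv w hw.1

lemma nearLeaf_subset (k : ℕ) : nearLeaf (forestAfter f k) ⊆ I f (k + 1) \ I f k := by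
  intro u hu
  refine ⟨isIsolated_pruneRound_of_mem_nearLeaf _ hu, fun h => ?_⟩
  obtain ⟨x, _, hx⟩ := hu
  exact h x hx.symm

lemma J_subset (k : ℕ) : J f k ⊆ I f (k + 1) \ I f k := fun _ h => h.1

lemma H_subset (k : ℕ) : H f k ⊆ I f (k + 1) \ I f k := by
  rw [H_eq]
  exact Set.sdiff_subset.trans (nearLeaf_subset f k)

/-- A vertex becomes isolated at most once. This makes the J_k disjoint and the H_k disjoint, the
source of absolute convergence. -/
lemma pairwise_disjoint_diff_I :
    Pairwise (Function.onFun Disjoint fun k => I f (k + 1) \ I f k) := by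
  refine (pairwise_disjoint_on _).2 fun i j hij => Set.disjoint_left.2 fun x hx hx' => ?_
  exact hx'.2 (I_mono f (Nat.succ_le_of_lt hij) hx.1)

lemma pairwise_disjoint_J : Pairwise (Function.onFun Disjoint (J f)) := fun _ _ h =>
  (pairwise_disjoint_diff_I f h).mono (J_subset f _) (J_subset f _)

lemma pairwise_disjoint_H : Pairwise (Function.onFun Disjoint (H f)) := fun _ _ h =>
  (pairwise_disjoint_diff_I f h).mono (H_subset f _) (H_subset f _)

lemma ncard_I_succ [Finite V] (k : ℕ) :
    (I f (k + 1)).ncard =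
      (I f k).ncard + (nearLeaf (forestAfter f k)).ncard + (J f k).ncard := by
  have h1 := Set.ncard_sdiff_add_ncard_of_subset (I_mono f (Nat.le_succ k))
  have h2 := Set.ncard_sdiff_add_ncard_of_subset (nearLeaf_subset f k)
  have h3 : J f k = (I f (k + 1) \ I f k) \ nearLeaf (forestAfter f k) := by
    ext x
    simp only [J, Set.mem_sdiff, mem_G_union_H_iff]
  rw [← h3] at h2
  simp only [Nat.succ_eq_add_one] at h1
  omega

end Partition

/-! ### Nullity of the adjacency matrix under leaf removal. -/

section Nullity

open scoped Classical

variable {V : Type*} [Fintype V] (f : SimpleGraph V)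

/-- The null space of the adjacency matrix. -/
noncomputable def nullSpace : Submodule ℝ (V → ℝ) := LinearMap.ker (f.adjMatrix ℝ).mulVecLin

variable {f} in
lemma mem_nullSpace {x : V → ℝ} : x ∈ nullSpace f ↔ ∀ v, ∑ w with f.Adj v w, x w = 0 := by
  simp only [nullSpace, LinearMap.mem_ker, Matrix.mulVecLin_apply, funext_iff, Pi.zero_apply,
    SimpleGraph.adjMatrix_mulVec_apply, SimpleGraph.neighborFinset_eq_filter]

lemma eq_zero_of_mem_nearLeaf {x : V → ℝ} (hx : x ∈ nullSpace f) {p : V} (hp : p ∈ nearLeaf f) :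
    x p = 0 := by
  obtain ⟨l, ⟨q, _, hu⟩, hl⟩ := hp
  have h := mem_nullSpace.1 hx l
  rwa [show (Finset.univ.filter fun w => f.Adj l w) = {p} from ?_, Finset.sum_singleton] at h
  ext w
  simp only [Finset.mem_filter, Finset.mem_univ, true_and, Finset.mem_singleton]
  exact ⟨fun hw => (hu w hw).trans (hu p hl).symm, fun hw => hw ▸ hl⟩

lemma sum_pruneRound {x : V → ℝ} (hx : ∀ p ∈ nearLeaf f, x p = 0) {v : V} (hv : v ∉ nearLeaf f) :
    ∑ w with (pruneRound f).Adj v w, x w = ∑ w with f.Adj v w, x w := by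
  rw [Finset.sum_filter, Finset.sum_filter]
  refine Finset.sum_congr rfl fun w _ => ?_
  by_cases hw : w ∈ nearLeaf f
  · simp [hx w hw]
  · simp [pruneRound_adj, hv, hw]

lemma sum_of_isIsolated (x : V → ℝ) {v : V} (hv : f.IsIsolated v) :
    ∑ w with f.Adj v w, x w = 0 := by
  rw [Finset.filter_false_of_mem fun w _ => hv w, Finset.sum_empty]

/-- The linear forms that cut out the null space of a graph in the null space of the graph after
a round of leaf removal. -/
noncomputable def leafForms :
    (V → ℝ) →ₗ[ℝ] (nearLeaf f → ℝ) × ((nearLeaf f \ {v | IsLeaf f v} : Set V) → ℝ) where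
  toFun x := (fun p => x p, fun p => ∑ w with f.Adj p w, x w)
  map_add' x y := by
    ext p <;> simp [Finset.sum_add_distrib]
  map_smul' c x := by
    ext p <;> simp [Finset.mul_sum]

/-- Once x vanishes near leaves, deleting edges does not change the equation at a vertex off
`nearLeaf`. At a vertex of `nearLeaf` the pruned equation is void, so the original one has to be
imposed, except at leaves, where it is automatic. -/
lemma mem_nullSpace_iff_leafForms {x : V → ℝ} :
    x ∈ nullSpace f ↔ x ∈ nullSpace (pruneRound f) ∧ leafForms f x = 0 := by
  constructor
  · intro hx
    have h0 : ∀ p ∈ nearLeaf f, x p = 0 := fun p hp => eq_zero_of_mem_nearLeaf f hx hp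
    refine ⟨mem_nullSpace.2 fun v => ?_, ?_⟩
    · by_cases hv : v ∈ nearLeaf f
      · exact sum_of_isIsolated _ _ (isIsolated_pruneRound_of_mem_nearLeaf f hv)
      · rw [sum_pruneRound f h0 hv, mem_nullSpace.1 hx]
    · ext p
      · exact h0 p p.2
      · exact mem_nullSpace.1 hx p
  · rintro ⟨hx, hl⟩
    have h0 : ∀ p ∈ nearLeaf f, x p = 0 := fun p hp => congrFun (congrArg Prod.fst hl) ⟨p, hp⟩
    refine mem_nullSpace.2 fun v => ?_
    by_cases hv : v ∈ nearLeaf f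
    · by_cases hvl : IsLeaf f v
      -- Two adjacent leaves: the only neighbor `l` of `v` is itself near the leaf `v`, so `x`
      -- already vanishes there.
      · obtain ⟨l, hl, hlv⟩ := hv
        have hln : l ∈ nearLeaf f := ⟨v, hvl, hlv.symm⟩
        refine Finset.sum_eq_zero fun w hw => ?_
        rw [hvl.unique (Finset.mem_filter.1 hw).2 hlv.symm]
        exact h0 l hln
      · exact congrFun (congrArg Prod.snd hl) ⟨v, hv, hvl⟩
    · rw [← sum_pruneRound f h0 hv, mem_nullSpace.1 hx]

/-- Independence of the forms: leaves are isolated after pruning, so their values are free, and a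
leaf chosen for each non-leaf `p` enters the equation of `p` alone. -/
lemma exists_leafForms_eq (a : nearLeaf f → ℝ)
    (b : (nearLeaf f \ {v | IsLeaf f v} : Set V) → ℝ) :
    ∃ x ∈ nullSpace (pruneRound f), leafForms f x = (a, b) := by
  have hleaf : ∀ p : (nearLeaf f \ {v | IsLeaf f v} : Set V), ∃ l, IsLeaf f l ∧ f.Adj l p :=
    fun p => p.2.1
  choose l hl hlp using hleaf
  have hlinj : ∀ p q, f.Adj q.1 (l p) → q = p := fun p q h =>
    Subtype.ext ((hl p).unique h.symm (hlp p))
  -- A leaf adjacent to `l p` could only be `p`, which is not a leaf. So correcting at `l p` does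
  -- not disturb the values prescribed on `nearLeaf`.
  have hln : ∀ p, l p ∉ nearLeaf f := by
    rintro p ⟨y, hy, hyl⟩
    exact p.2.2 ((hl p).unique (hlp p) hyl.symm ▸ hy)
  let a' : V → ℝ := fun v => if h : v ∈ nearLeaf f then a ⟨v, h⟩ else 0
  -- The defect in the equation at `p` once `a` is prescribed near leaves; `x` places it at `l p`.
  let c : (nearLeaf f \ {v | IsLeaf f v} : Set V) → ℝ := fun p => b p - ∑ w with f.Adj p w, a' w
  let x : V → ℝ := fun v => a' v + ∑ p, if v = l p then c p else 0
  have hx0 : ∀ v, ¬ (pruneRound f).IsIsolated v → x v = 0 := by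
    intro v hv
    have h1 : v ∉ nearLeaf f := fun h => hv (isIsolated_pruneRound_of_mem_nearLeaf f h)
    have h2 : ∀ p, v ≠ l p := fun p h => hv (h ▸ isIsolated_pruneRound_of_isLeaf f (hl p))
    simp [x, a', h1, h2]
  refine ⟨x, mem_nullSpace.2 fun v => Finset.sum_eq_zero fun w hw => hx0 w fun h => ?_, ?_⟩
  · exact h v (Finset.mem_filter.1 hw).2.symm
  · ext p
    · have : ∀ q, p.1 ≠ l q := fun q h => hln q (h ▸ p.2)
      simp [leafForms, x, a', this]
    · have hsum : ∑ w with f.Adj p w, ∑ q, (if w = l q then c q else 0) = c p := by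
        rw [Finset.sum_comm, Finset.sum_eq_single p]
        · rw [Finset.sum_ite_eq' , if_pos]
          simpa using (hlp p).symm
        · intro q _ hqp
          refine Finset.sum_eq_zero fun w hw => if_neg fun h => hqp ?_
          exact (hlinj q p (h ▸ (Finset.mem_filter.1 hw).2)).symm
        · simp
      change ∑ w with f.Adj p w, (a' w + ∑ q, if w = l q then c q else 0) = b p
      rw [Finset.sum_add_distrib, hsum]
      simp [c]

lemma finrank_nullSpace_pruneRound :
    Module.finrank ℝ (nullSpace (pruneRound f)) =
      Module.finrank ℝ (nullSpace f) + (nearLeaf f).ncard +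
        (nearLeaf f \ {v | IsLeaf f v}).ncard := by
  have hle : nullSpace f ≤ nullSpace (pruneRound f) := fun x hx =>
    ((mem_nullSpace_iff_leafForms f).1 hx).1
  let Λ := (leafForms f).domRestrict (nullSpace (pruneRound f))
  have hker : LinearMap.ker Λ = (nullSpace f).comap (nullSpace (pruneRound f)).subtype := by
    ext x
    rw [Submodule.mem_comap, Submodule.subtype_apply, mem_nullSpace_iff_leafForms]
    exact ⟨fun h => ⟨x.2, h⟩, fun h => h.2⟩
  have hrange : LinearMap.range Λ = ⊤ := by
    refine LinearMap.range_eq_top.2 fun ⟨a, b⟩ => ?_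
    obtain ⟨x, hx, h⟩ := exists_leafForms_eq f a b
    exact ⟨⟨x, hx⟩, h⟩
  have h := Λ.finrank_range_add_finrank_ker
  rw [hrange, finrank_top, hker, (Submodule.comapSubtypeEquivOfLe hle).finrank_eq,
    Module.finrank_prod, Module.finrank_fintype_fun_eq_card, Module.finrank_fintype_fun_eq_card,
    ← Nat.card_eq_fintype_card, ← Nat.card_eq_fintype_card, Nat.card_coe_set_eq,
    Nat.card_coe_set_eq] at h
  omega

lemma finrank_nullSpace_eq (m : ℕ) :
    (Module.finrank ℝ (nullSpace f) : ℝ) =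
      (I f 0).ncard + ∑ k ∈ Finset.range m, (((J f k).ncard : ℝ) - (H f k).ncard) +
        ((Module.finrank ℝ (nullSpace (forestAfter f m)) : ℝ) - (I f m).ncard) := by
  induction m with
  | zero =>
    rw [Finset.sum_range_zero, add_zero, add_sub_cancel]
    rfl
  | succ m ih =>
    have h1 : Module.finrank ℝ (nullSpace (forestAfter f (m + 1))) =
        Module.finrank ℝ (nullSpace (forestAfter f m)) + (nearLeaf (forestAfter f m)).ncard +
          (H f m).ncard := by
      rw [H_eq]
      exact finrank_nullSpace_pruneRound (forestAfter f m)
    rw [ih, Finset.sum_range_succ, h1, ncard_I_succ]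
    push_cast
    ring

/-- The indicators of isolated vertices are independent null vectors. -/
lemma ncard_isIsolated_le_finrank_nullSpace :
    {v | f.IsIsolated v}.ncard ≤ Module.finrank ℝ (nullSpace f) := by
  have hli : LinearIndependent ℝ fun v : {v | f.IsIsolated v} =>
      (⟨Pi.single v.1 1, mem_nullSpace.2 fun u => Finset.sum_eq_zero fun w hw => by
        have : w ≠ v.1 := fun h => v.2 u (h ▸ (Finset.mem_filter.1 hw).2.symm)
        simp [this]⟩ : nullSpace f) := by
    refine LinearIndependent.of_comp (nullSpace f).subtype ?_
    convert (Pi.basisFun ℝ V).linearIndependent.comp (fun v : {v | f.IsIsolated v} => v.1)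
      Subtype.val_injective using 1
    ext v
    simp
  rw [← Nat.card_coe_set_eq, Nat.card_eq_fintype_card]
  exact hli.fintype_card_le_finrank

/-- The nullity of f_m lies between |I_m| and |V|, which bounds the remainder of the telescoping
identity. -/
lemma abs_finrank_nullSpace_sub_le (m : ℕ) :
    |(Module.finrank ℝ (nullSpace f) : ℝ) -
      ∑ k ∈ Finset.range m, (((J f k).ncard : ℝ) - (H f k).ncard)| ≤
        (I f 0).ncard + (I f m)ᶜ.ncard := by
  have h1 : (I f m).ncard ≤ Module.finrank ℝ (nullSpace (forestAfter f m)) :=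
    ncard_isIsolated_le_finrank_nullSpace _
  have h2 : Module.finrank ℝ (nullSpace (forestAfter f m)) ≤ Nat.card V := by
    refine (Submodule.finrank_le _).trans ?_
    rw [Module.finrank_fintype_fun_eq_card, Nat.card_eq_fintype_card]
  have h3 := Set.ncard_add_ncard_compl (I f m)
  have h1' : ((I f m).ncard : ℝ) ≤ Module.finrank ℝ (nullSpace (forestAfter f m)) := by
    exact_mod_cast h1
  have h4 : (Module.finrank ℝ (nullSpace (forestAfter f m)) : ℝ) ≤
      (I f m).ncard + (I f m)ᶜ.ncard := by exact_mod_cast h3 ▸ h2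
  rw [finrank_nullSpace_eq f m, abs_le]
  constructor
  · have : (0 : ℝ) ≤ (I f 0).ncard := Nat.cast_nonneg _
    have : (0 : ℝ) ≤ (I f m)ᶜ.ncard := Nat.cast_nonneg _
    linarith
  · linarith

end Nullity

end KarpSipser

end FringeTrees

namespace FringeTrees

open KarpSipser

/-! ### Parents, descendants and the path decomposition of a rooted tree. -/

namespace LTree

variable (t : LTree)

/-- `c` is a child of `v`. -/
def IsChild (c v : Fin t.size) : Prop := t.graph.Adj c v ∧ v ∈ (t.pathToRoot c).support

variable {t}

lemma support_pathToRoot_subset {w x : Fin t.size} (hx : x ∈ (t.pathToRoot w).support) :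
    (t.pathToRoot x).support ⊆ (t.pathToRoot w).support := by
  rw [← t.dropUntil_pathToRoot hx]
  exact SimpleGraph.Walk.support_dropUntil_subset_support _ _

lemma isChild_or_isChild {u v : Fin t.size} (h : t.graph.Adj u v) :
    t.IsChild u v ∨ t.IsChild v u := by
  by_cases hv : v ∈ (t.pathToRoot u).support
  · exact Or.inl ⟨h, hv⟩
  · refine Or.inr ⟨h.symm, ?_⟩
    rw [← t.eq_pathToRoot _ ((SimpleGraph.Walk.cons_isPath_iff h.symm _).2
      ⟨t.isPath_pathToRoot u, hv⟩), SimpleGraph.Walk.support_cons]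
    exact List.mem_cons_of_mem _ (SimpleGraph.Walk.start_mem_support _)

/-- Each path to the root is a final segment of the other, so their lengths agree and the initial
piece is trivial. -/
lemma eq_of_mem_support_pathToRoot {u v : Fin t.size} (hu : u ∈ (t.pathToRoot v).support)
    (hv : v ∈ (t.pathToRoot u).support) : u = v := by
  have h1 := congrArg SimpleGraph.Walk.length (t.dropUntil_pathToRoot hu)
  have h2 := congrArg SimpleGraph.Walk.length (t.dropUntil_pathToRoot hv)
  have h3 := congrArg SimpleGraph.Walk.length (SimpleGraph.Walk.take_spec _ hu)
  have h4 := congrArg SimpleGraph.Walk.length (SimpleGraph.Walk.take_spec _ hv)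
  rw [SimpleGraph.Walk.length_append] at h3 h4
  exact (SimpleGraph.Walk.eq_of_length_eq_zero
    (p := (t.pathToRoot v).takeUntil u hu) (by omega)).symm

lemma IsChild.notMem {c v : Fin t.size} (h : t.IsChild c v) : c ∉ (t.pathToRoot v).support :=
  fun hc => h.1.ne (eq_of_mem_support_pathToRoot hc h.2)

lemma IsChild.support {c v : Fin t.size} (h : t.IsChild c v) :
    (t.pathToRoot c).support = c :: (t.pathToRoot v).support := by
  rw [← t.eq_pathToRoot _ ((SimpleGraph.Walk.cons_isPath_iff h.1 _).2
      ⟨t.isPath_pathToRoot v, h.notMem⟩), SimpleGraph.Walk.support_cons]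

lemma IsChild.unique {c v w : Fin t.size} (hv : t.IsChild c v) (hw : t.IsChild c w) : v = w := by
  have h := hv.support.symm.trans hw.support
  rw [← SimpleGraph.Walk.cons_tail_support (t.pathToRoot v),
    ← SimpleGraph.Walk.cons_tail_support (t.pathToRoot w)] at h
  simp only [List.cons.injEq, true_and] at h
  exact h.1

lemma mem_fringeSet_zero {v w : Fin t.size} :
    w ∈ t.fringeSet v 0 ↔ v ∈ (t.pathToRoot w).support := by
  simp [fringeSet, ancestor]

lemma self_mem_fringeSet_zero (v : Fin t.size) : v ∈ t.fringeSet v 0 :=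
  mem_fringeSet_zero.2 (SimpleGraph.Walk.start_mem_support _)

lemma IsChild.ncard_fringeSet_lt {c v : Fin t.size} (h : t.IsChild c v) :
    (t.fringeSet c 0).ncard < (t.fringeSet v 0).ncard := by
  refine Set.ncard_lt_ncard ((Set.ssubset_iff_of_subset fun w hw => ?_).2
    ⟨v, self_mem_fringeSet_zero v, fun hv => h.notMem (mem_fringeSet_zero.1 hv)⟩)
  exact mem_fringeSet_zero.2 (support_pathToRoot_subset (mem_fringeSet_zero.1 hw) h.2)

lemma ncard_fringeSet_pos (v : Fin t.size) : 0 < (t.fringeSet v 0).ncard :=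
  (Set.ncard_pos).2 ⟨v, self_mem_fringeSet_zero v⟩

/-- Leaf removal works upwards from the bottom of the tree: a child has a strictly smaller subtree,
so it loses its own children a round earlier. -/
lemma not_adj_child_forestAfter (k : ℕ) {v : Fin t.size} (hv : (t.fringeSet v 0).ncard ≤ k + 1)
    {c : Fin t.size} (hc : t.IsChild c v) : ¬ (forestAfter t.graph k).Adj v c := by
  induction k generalizing v c with
  | zero =>
    have := hc.ncard_fringeSet_lt
    have := ncard_fringeSet_pos c
    omega
  | succ k ih =>
    intro hadj
    have hlt := hc.ncard_fringeSet_lt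
    -- By induction `c` keeps no edge to its children, so it is a leaf hanging from `v`, and the
    -- round removes every edge at `v`.
    refine hadj.2.1 ⟨c, ⟨v, hadj.1.symm, fun w hw => ?_⟩, hadj.1.symm⟩
    rcases isChild_or_isChild (forestAfter_le _ _ hw) with h | h
    · exact h.unique hc
    · exact absurd hw (ih (by omega) h)

/-- A vertex with a small subtree becomes isolated after few rounds of leaf removal. -/
lemma mem_I_of_ncard_fringeSet_le (m : ℕ) {v : Fin t.size} (hv : (t.fringeSet v 0).ncard ≤ m) :
    v ∈ I t.graph m := by
  cases m with
  | zero =>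
    have := ncard_fringeSet_pos v
    omega
  | succ k =>
    intro w hw
    have hpar : ∀ y, (forestAfter t.graph k).Adj v y → t.IsChild v y := fun y hy =>
      (isChild_or_isChild (forestAfter_le _ _ hy)).resolve_right
        fun h => not_adj_child_forestAfter k hv h hy
    -- Only the edge to the parent can be left, which would make `v` a leaf; one further round
    -- deletes that edge.
    exact hw.2.2 ⟨v, ⟨w, hw.1, fun y hy => (hpar y hy).unique (hpar w hw.1)⟩, hw.1⟩

lemma ancestor_zero (v : Fin t.size) : t.ancestor v 0 = v := SimpleGraph.Walk.getVert_zero _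

lemma ancestor_mem_support (v : Fin t.size) {i j : ℕ} (hij : i ≤ j) :
    t.ancestor v j ∈ (t.pathToRoot (t.ancestor v i)).support := by
  have hdrop : (t.pathToRoot v).drop i = t.pathToRoot (t.ancestor v i) :=
    t.eq_pathToRoot _ ((t.isPath_pathToRoot v).drop _)
  rw [← hdrop]
  have h : ((t.pathToRoot v).drop i).getVert (j - i) = t.ancestor v j := by
    rw [SimpleGraph.Walk.drop_getVert, Nat.add_sub_cancel' hij]
    rfl
  rw [← h]
  exact SimpleGraph.Walk.getVert_mem_support _ _

lemma isChild_ancestor (v : Fin t.size) {k : ℕ} (hk : k < t.height v) :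
    t.IsChild (t.ancestor v k) (t.ancestor v (k + 1)) :=
  ⟨(t.pathToRoot v).adj_getVert_succ hk, ancestor_mem_support v (Nat.le_succ k)⟩

lemma mem_fringeSet_iff {v w : Fin t.size} {k : ℕ} :
    w ∈ t.fringeSet v k ↔ t.ancestor v k ∈ (t.pathToRoot w).support ∧
      ∀ j < k, t.ancestor v j ∉ (t.pathToRoot w).support := by
  cases k with
  | zero => simp [fringeSet]
  | succ k =>
    refine and_congr_right fun _ => ⟨fun h j hj hmem => h ?_, fun h => h k (Nat.lt_succ_self k)⟩
    exact support_pathToRoot_subset hmem (ancestor_mem_support v (Nat.le_of_lt_succ hj))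

lemma eq_of_mem_fringeSet {v w : Fin t.size} {i j : ℕ} (hi : w ∈ t.fringeSet v i)
    (hj : w ∈ t.fringeSet v j) : i = j := by
  rw [mem_fringeSet_iff] at hi hj
  rcases lt_trichotomy i j with h | h | h
  · exact absurd hi.1 (hj.2 i h)
  · exact h
  · exact absurd hj.1 (hi.2 j h)

/-- The pieces are joined only along the path to the root, just as in the infinite tree. Strictness
of `hk` ensures that v_k has a parent. -/
lemma adj_fringeSet_cases {v w u : Fin t.size} {k : ℕ} (hk : k < t.height v)
    (hw : w ∈ t.fringeSet v k) (hwu : t.graph.Adj w u) :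
    u ∈ t.fringeSet v k ∨ (w = t.ancestor v k ∧ u = t.ancestor v (k + 1)) ∨
      ∃ j, k = j + 1 ∧ w = t.ancestor v k ∧ u = t.ancestor v j := by
  rw [mem_fringeSet_iff] at hw
  rcases isChild_or_isChild hwu with h | h
  · rw [h.support] at hw
    rcases List.mem_cons.1 hw.1 with h' | h'
    · refine Or.inr (Or.inl ⟨h'.symm, ?_⟩)
      subst h'
      exact h.unique (isChild_ancestor v hk)
    · exact Or.inl (mem_fringeSet_iff.2
        ⟨h', fun j hj hmem => hw.2 j hj (List.mem_cons_of_mem _ hmem)⟩)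
  · by_cases hu : u ∈ t.fringeSet v k
    · exact Or.inl hu
    · rw [mem_fringeSet_iff, h.support] at hu
      have : ∃ j < k, t.ancestor v j ∈ u :: (t.pathToRoot w).support := by
        by_contra hcon
        push Not at hcon
        exact hu ⟨List.mem_cons_of_mem _ hw.1, hcon⟩
      obtain ⟨j, hj, hmem⟩ := this
      rcases List.mem_cons.1 hmem with h' | h'
      · subst h'
        have hwj : w = t.ancestor v (j + 1) := h.unique (isChild_ancestor v (by omega))
        have hjk : k = j + 1 := by
          by_contra hne
          refine hw.2 (j + 1) (by omega) ?_
          rw [← hwj]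
          exact SimpleGraph.Walk.start_mem_support _
        exact Or.inr (Or.inr ⟨j, hjk, hjk ▸ hwj, rfl⟩)
      · exact absurd h' (hw.2 j hj)

end LTree

/-! ### Local structure of the infinite tree -/

section SinTree

variable {τ : ℕ → UTree}

/-- The root of the `k`-th tree, as a vertex of the infinite tree. -/
noncomputable def spine (τ : ℕ → UTree) (k : ℕ) : SinVertex τ := ⟨k, (τ k).rep.root⟩

lemma sinTree_adj_of_adj {k : ℕ} {a b : Fin (τ k).rep.size} (h : (τ k).rep.graph.Adj a b) :
    (sinTree τ).Adj ⟨k, a⟩ ⟨k, b⟩ := by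
  refine (SimpleGraph.fromRel_adj _ _ _).2 ⟨fun he => h.ne ?_, Or.inl (Or.inl ⟨k, a, b, h, rfl, rfl⟩)⟩
  simpa using he

lemma sinTree_adj_spine (k : ℕ) : (sinTree τ).Adj (spine τ k) (spine τ (k + 1)) := by
  refine (SimpleGraph.fromRel_adj _ _ _).2 ⟨fun he => ?_, Or.inl (Or.inr ⟨k, rfl, rfl⟩)⟩
  simpa [spine] using congrArg Sigma.fst he

lemma sinTree_adj_cases {x y : SinVertex τ} (h : (sinTree τ).Adj x y) :
    (∃ (k : ℕ) (a b : Fin (τ k).rep.size),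
      (τ k).rep.graph.Adj a b ∧ x = ⟨k, a⟩ ∧ y = ⟨k, b⟩) ∨
    (∃ k, x = spine τ k ∧ y = spine τ (k + 1)) ∨ ∃ k, x = spine τ (k + 1) ∧ y = spine τ k := by
  obtain ⟨_, (h | ⟨k, h⟩) | ⟨k, a, b, hab, h⟩ | ⟨k, h⟩⟩ := (SimpleGraph.fromRel_adj _ _ _).1 h
  · exact Or.inl h
  · exact Or.inr (Or.inl ⟨k, h⟩)
  · exact Or.inl ⟨k, b, a, hab.symm, h.2, h.1⟩
  · exact Or.inr (Or.inr ⟨k, h.2, h.1⟩)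

lemma fst_le_of_sinTree_adj {x y : SinVertex τ} (h : (sinTree τ).Adj x y) : y.1 ≤ x.1 + 1 := by
  rcases sinTree_adj_cases h with ⟨k, a, b, _, rfl, rfl⟩ | ⟨k, rfl, rfl⟩ | ⟨k, rfl, rfl⟩ <;>
    simp only [spine] <;> omega

/-- An edge raises the index of the piece by at most one, so r steps from `x` stay in pieces with
index at most `x.1 + r`. Surjectivity is asked only below `N`, as a root in piece `N` also has a
neighbor in piece `N + 1`. -/
lemma localIso_sinTree {V : Type*} {f : SimpleGraph V} {φ : SinVertex τ → V} {N : ℕ}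
    (hadj : ∀ k ≤ N, ∀ a b, (τ k).rep.graph.Adj a b → f.Adj (φ ⟨k, a⟩) (φ ⟨k, b⟩))
    (hspine : ∀ k < N, f.Adj (φ (spine τ k)) (φ (spine τ (k + 1))))
    (hinj : ∀ x y : SinVertex τ, x.1 ≤ N → y.1 ≤ N → φ x = φ y → x = y)
    (hsurj : ∀ x : SinVertex τ, x.1 < N → ∀ u, f.Adj (φ x) u → ∃ y, (sinTree τ).Adj x y ∧ φ y = u)
    (r : ℕ) {x : SinVertex τ} (hx : x.1 + r ≤ N) : LocalIso (sinTree τ) f φ r x := by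
  induction r generalizing x with
  | zero => trivial
  | succ r ih =>
    refine ⟨⟨fun y hy => ?_, fun y hy z hz => ?_, fun u hu => hsurj x (by omega) u hu⟩,
      fun y hy => ih ?_⟩
    · have hle := fst_le_of_sinTree_adj hy
      rcases sinTree_adj_cases hy with ⟨k, a, b, h, rfl, rfl⟩ | ⟨k, rfl, rfl⟩ | ⟨k, rfl, rfl⟩
      · exact hadj k (by simp only at hx; omega) a b h
      · exact hspine k (by simp only [spine] at hx; omega)
      · exact (hspine k (by simp only [spine] at hx; omega)).symm
    · have := fst_le_of_sinTree_adj hy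
      have := fst_le_of_sinTree_adj hz
      exact hinj y z (by omega) (by omega)
    · have := fst_le_of_sinTree_adj hy
      omega

lemma exists_localIso_of_eq {τ' : ℕ → UTree} {N : ℕ} (h : ∀ k ≤ N, τ k = τ' k) :
    ∃ φ : SinVertex τ → SinVertex τ', φ (sinRoot τ) = sinRoot τ' ∧
      LocalIso (sinTree τ) (sinTree τ') φ N (sinRoot τ) := by
  classical
  have he : ∀ k, k ≤ N → ∃ e : (τ k).rep.graph ≃g (τ' k).rep.graph,
      e (τ k).rep.root = (τ' k).rep.root := fun k hk => by
    rw [h k hk]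
    exact ⟨SimpleGraph.Iso.refl, rfl⟩
  choose e he using he
  let φ : SinVertex τ → SinVertex τ' := fun x =>
    if hx : x.1 ≤ N then ⟨x.1, e x.1 hx x.2⟩ else sinRoot τ'
  have hφ : ∀ k (hk : k ≤ N) a, φ ⟨k, a⟩ = ⟨k, e k hk a⟩ := fun k hk a => dif_pos hk
  have hφs : ∀ k, k ≤ N → φ (spine τ k) = spine τ' k := fun k hk => by
    rw [spine, hφ k hk, he]
    rfl
  refine ⟨φ, hφs 0 (Nat.zero_le _), localIso_sinTree ?_ ?_ ?_ ?_ N (Nat.zero_add N).le⟩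
  · intro k hk a b hab
    rw [hφ k hk, hφ k hk]
    exact sinTree_adj_of_adj ((e k hk).map_adj_iff.2 hab)
  · intro k hk
    rw [hφs k hk.le, hφs (k + 1) hk]
    exact sinTree_adj_spine k
  · rintro ⟨k, a⟩ ⟨l, b⟩ hk hl hab
    rw [hφ k hk, hφ l hl] at hab
    obtain rfl : k = l := congrArg Sigma.fst hab
    simpa using hab
  · rintro ⟨k, a⟩ hk u hu
    simp only at hk
    rw [hφ k hk.le] at hu
    have hroot : ∀ l, (⟨k, e k hk.le a⟩ : SinVertex τ') = spine τ' l →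
        l = k ∧ (⟨k, a⟩ : SinVertex τ) = spine τ l := by
      intro l hl
      obtain rfl : k = l := congrArg Sigma.fst hl
      refine ⟨rfl, ?_⟩
      have : e k hk.le a = (τ' k).rep.root := by simpa [spine] using hl
      rw [← he k hk.le] at this
      rw [(e k hk.le).injective this]
      rfl
    rcases sinTree_adj_cases hu with ⟨l, b, c, hbc, h1, rfl⟩ | ⟨l, h1, rfl⟩ | ⟨l, h1, rfl⟩
    · obtain rfl : k = l := congrArg Sigma.fst h1
      have h1 : e k hk.le a = b := by simpa using h1
      refine ⟨⟨k, (e k hk.le).symm c⟩, sinTree_adj_of_adj ?_, ?_⟩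
      · rw [← (e k hk.le).map_adj_iff, h1]
        simpa using hbc
      · rw [hφ k hk.le]
        simp
    · obtain ⟨rfl, h2⟩ := hroot l h1
      exact ⟨spine τ (l + 1), h2 ▸ sinTree_adj_spine l, hφs _ hk⟩
    · obtain ⟨rfl, h2⟩ := hroot (l + 1) h1
      exact ⟨spine τ l, h2 ▸ (sinTree_adj_spine l).symm, hφs _ (by omega)⟩

end SinTree

lemma UTree.exists_iso_rep_ofGraph {V : Type} [Fintype V] (f : SimpleGraph V) (hf : f.IsTree)
    (r : V) : ∃ e : (UTree.ofGraph f hf r).rep.graph ≃g f, e (UTree.ofGraph f hf r).rep.root = r := by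
  obtain ⟨e, he⟩ := Quotient.exact (Quotient.out_eq (UTree.ofGraph f hf r))
  refine ⟨(SimpleGraph.Iso.comap (Fintype.equivFin V).symm f).comp e, ?_⟩
  change (Fintype.equivFin V).symm (e _) = r
  erw [he]
  exact (Fintype.equivFin V).symm_apply_apply r

/-- The tree with one vertex. -/
noncomputable def UTree.single : UTree := UTree.ofGraph (⊥ : SimpleGraph Unit) .of_subsingleton ()

/-- The sequence of trees obtained by replacing the adjoined point with the one-vertex tree. -/
noncomputable def fillSeq (x : ℕ → UTreeStar) (k : ℕ) : UTree := (x k).getD UTree.single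

/-! ### Neighborhoods of a vertex read off from its fringe sequence. -/

namespace LTree

variable {t : LTree}

lemma exists_iso_fringe (v : Fin t.size) {k : ℕ} (hk : k ≤ t.height v) :
    ∃ e : (fillSeq (t.fringe v) k).rep.graph ≃g t.graph.induce (t.fringeSet v k),
      (e (fillSeq (t.fringe v) k).rep.root).1 = t.ancestor v k := by
  classical
  have h : fillSeq (t.fringe v) k =
      UTree.ofGraph (t.graph.induce (t.fringeSet v k)) (t.fringeSet_isTree v k hk)
      ⟨t.ancestor v k, t.ancestor_mem_fringeSet v k hk⟩ := by
    rw [fillSeq, fringe, dif_pos hk, Option.getD_some]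
  rw [h]
  obtain ⟨e, he⟩ := UTree.exists_iso_rep_ofGraph (t.graph.induce (t.fringeSet v k))
    (t.fringeSet_isTree v k hk) ⟨t.ancestor v k, t.ancestor_mem_fringeSet v k hk⟩
  exact ⟨e, congrArg Subtype.val he⟩

lemma size_fringe_zero (v : Fin t.size) :
    (fillSeq (t.fringe v) 0).rep.size = (t.fringeSet v 0).ncard := by
  obtain ⟨e, _⟩ := exists_iso_fringe v (Nat.zero_le _)
  rw [← Nat.card_coe_set_eq, ← Nat.card_congr e.toEquiv, Nat.card_fin]

lemma fringe_eq_none_iff (v : Fin t.size) (k : ℕ) : t.fringe v k = none ↔ t.height v < k := by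
  rw [fringe]
  split_ifs with h
  · simpa using h
  · simpa using h

lemma exists_localIso_fringe (v : Fin t.size) :
    ∃ φ : SinVertex (fillSeq (t.fringe v)) → Fin t.size, φ (sinRoot (fillSeq (t.fringe v))) = v ∧
      LocalIso (sinTree (fillSeq (t.fringe v))) t.graph φ (t.height v)
        (sinRoot (fillSeq (t.fringe v))) := by
  classical
  have he : ∀ k, k ≤ t.height v → ∃ e : (fillSeq (t.fringe v) k).rep.graph ≃g
      t.graph.induce (t.fringeSet v k), (e (fillSeq (t.fringe v) k).rep.root).1 =
        t.ancestor v k := fun k hk => exists_iso_fringe v hk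
  -- Only the isomorphisms with the pieces matter from here on; beyond the height the sequence may
  -- be anything.
  generalize fillSeq (t.fringe v) = τ at he ⊢
  choose e he using he
  let φ : SinVertex τ → Fin t.size := fun x =>
    if hx : x.1 ≤ t.height v then (e x.1 hx x.2).1 else v
  have hφ : ∀ k (hk : k ≤ t.height v) a, φ ⟨k, a⟩ = (e k hk a).1 := fun k hk a => dif_pos hk
  have hφs : ∀ k, k ≤ t.height v → φ (spine τ k) = t.ancestor v k := fun k hk => by
    rw [spine, hφ k hk, he]
  refine ⟨φ, (hφs 0 (Nat.zero_le _)).trans (ancestor_zero v),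
    localIso_sinTree ?_ ?_ ?_ ?_ _ (Nat.zero_add _).le⟩
  · intro k hk a b hab
    rw [hφ k hk, hφ k hk]
    exact (e k hk).map_adj_iff.2 hab
  · intro k hk
    rw [hφs k hk.le, hφs (k + 1) hk]
    exact (isChild_ancestor v hk).1
  · rintro ⟨k, a⟩ ⟨l, b⟩ hk hl hab
    rw [hφ k hk, hφ l hl] at hab
    obtain rfl : k = l := eq_of_mem_fringeSet (e k hk a).2 (hab ▸ (e l hl b).2)
    rw [(e k hk).injective (Subtype.ext hab)]
  · rintro ⟨k, a⟩ hk u hu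
    simp only at hk
    rw [hφ k hk.le] at hu
    have hroot : (e k hk.le a).1 = t.ancestor v k → (⟨k, a⟩ : SinVertex τ) = spine τ k := by
      intro h
      rw [← he k hk.le] at h
      rw [(e k hk.le).injective (Subtype.ext h)]
      rfl
    rcases adj_fringeSet_cases hk (e k hk.le a).2 hu with h | ⟨h, rfl⟩ | ⟨j, rfl, h, rfl⟩
    · refine ⟨⟨k, (e k hk.le).symm ⟨u, h⟩⟩, sinTree_adj_of_adj ?_, ?_⟩
      · rw [← (e k hk.le).map_adj_iff]
        simpa using hu
      · rw [hφ k hk.le]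
        simp
    · exact ⟨spine τ (k + 1), hroot h ▸ sinTree_adj_spine k, hφs _ hk⟩
    · exact ⟨spine τ j, hroot h ▸ (sinTree_adj_spine j).symm, hφs _ (by omega)⟩

end LTree

end FringeTrees

namespace FringeTrees

open KarpSipser

/-! ### Finite trees: the mass at zero of the spectral distribution -/

lemma real_inv_smul_sum_dirac {α : Type*} [MeasurableSpace α] {n : ℕ} (F : Fin n → α) {A : Set α}
    (hA : MeasurableSet A) :
    ((n : ℝ≥0∞)⁻¹ • ∑ v : Fin n, Measure.dirac (F v)).real A = ({v | F v ∈ A}.ncard : ℝ) / n := by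
  classical
  rw [measureReal_def, Measure.smul_apply, Measure.finsetSum_apply]
  simp_rw [Measure.dirac_apply' _ hA, Set.indicator_apply, Pi.one_apply]
  rw [Finset.sum_boole, smul_eq_mul, ENNReal.toReal_mul, ENNReal.toReal_inv, ENNReal.toReal_natCast,
    ENNReal.toReal_natCast, div_eq_inv_mul, Set.ncard_eq_toFinset_card']
  congr 3
  ext v
  simp

/-! ### Clopen events for the fringe sequence. -/

/-- Sets of sequences that are determined by finitely many coordinates. -/
lemma isClopen_of_eq_of_le {A : Set (ℕ → UTreeStar)} (N : ℕ)
    (h : ∀ x y : ℕ → UTreeStar, (∀ k ≤ N, x k = y k) → x ∈ A → y ∈ A) : IsClopen A := by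
  let F : (ℕ → UTreeStar) → (Fin (N + 1) → UTreeStar) := fun x i => x i
  have hF : Continuous F := continuous_pi fun i => continuous_apply _
  have hA : A = F ⁻¹' (F '' A) := by
    refine (Set.subset_preimage_image F A).antisymm ?_
    rintro y ⟨x, hx, hxy⟩
    exact h x y (fun k hk => congrFun hxy ⟨k, Nat.lt_succ_of_le hk⟩) hx
  rw [hA]
  exact (isClopen_discrete _).preimage hF

/-- The sequences for which the root of the infinite tree belongs to `J_k`. -/
def rootInJ (k : ℕ) : Set (ℕ → UTreeStar) :=
  {x | sinRoot (fillSeq x) ∈ J (sinTree (fillSeq x)) k}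

/-- The sequences for which the root of the infinite tree belongs to `H_k`. -/
def rootInH (k : ℕ) : Set (ℕ → UTreeStar) :=
  {x | sinRoot (fillSeq x) ∈ H (sinTree (fillSeq x)) k}

/-- The sequences with the adjoined point at position `k`. -/
def starAt (k : ℕ) : Set (ℕ → UTreeStar) := {x | x k = none}

/-- The sequences whose first tree has more than `m` vertices. -/
def headSizeGt (m : ℕ) : Set (ℕ → UTreeStar) := {x | m < (fillSeq x 0).rep.size}

lemma fillSeq_congr {x y : ℕ → UTreeStar} {N : ℕ} (h : ∀ k ≤ N, x k = y k) :
    ∀ k ≤ N, fillSeq x k = fillSeq y k := fun k hk => by rw [fillSeq, fillSeq, h k hk]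

lemma isClopen_rootInJ (k : ℕ) : IsClopen (rootInJ k) := by
  refine isClopen_of_eq_of_le (2 * k + 3) fun x y h hx => ?_
  obtain ⟨φ, hφ, hloc⟩ := exists_localIso_of_eq (fillSeq_congr h)
  have := (mem_J_iff_of_localIso k hloc).1 hx
  rwa [hφ] at this

lemma isClopen_rootInH (k : ℕ) : IsClopen (rootInH k) := by
  refine isClopen_of_eq_of_le (2 * k + 3) fun x y h hx => ?_
  obtain ⟨φ, hφ, hloc⟩ := exists_localIso_of_eq (fillSeq_congr h)
  have := (mem_H_iff_of_localIso k hloc).1 hx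
  rwa [hφ] at this

lemma isClopen_starAt (k : ℕ) : IsClopen (starAt k) :=
  isClopen_of_eq_of_le k fun _ _ h hx => (h k le_rfl).symm.trans hx

lemma isClopen_headSizeGt (m : ℕ) : IsClopen (headSizeGt m) := by
  refine isClopen_of_eq_of_le 0 fun x y h hx => ?_
  rw [headSizeGt, Set.mem_ofPred_eq, ← fillSeq_congr h 0 le_rfl]
  exact hx

/-! ### Comparison of the nullity with fringe probabilities. -/

namespace LTree

variable (t : LTree)

lemma real_fringeLaw {A : Set (ℕ → UTreeStar)} (hA : IsClopen A) :
    (t.fringeLaw : Measure (ℕ → UTreeStar)).real A =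
      ({v | t.fringe v ∈ A}.ncard : ℝ) / t.size :=
  real_inv_smul_sum_dirac t.fringe hA.isOpen.measurableSet

/-- The rank of a Hermitian matrix counts its nonzero eigenvalues; rank-nullity does the rest. -/
lemma ncard_eigenvalues_eq_zero {n : ℕ} (f : SimpleGraph (Fin n)) [DecidableRel f.Adj] :
    {i | (f.isHermitian_adjMatrix ℝ).eigenvalues i = 0}.ncard =
      Module.finrank ℝ (nullSpace f) := by
  classical
  have h1 := (f.isHermitian_adjMatrix ℝ).rank_eq_card_non_zero_eigs
  have h2 := (f.adjMatrix ℝ).mulVecLin.finrank_range_add_finrank_ker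
  have h3 := Set.ncard_add_ncard_compl {i | (f.isHermitian_adjMatrix ℝ).eigenvalues i = 0}
  have h4 : {i | (f.isHermitian_adjMatrix ℝ).eigenvalues i = 0}ᶜ.ncard =
      Fintype.card {i // (f.isHermitian_adjMatrix ℝ).eigenvalues i ≠ 0} := by
    rw [← Nat.card_eq_fintype_card]
    rfl
  have h5 : nullSpace f = LinearMap.ker (f.adjMatrix ℝ).mulVecLin := by
    rw [nullSpace]
    congr!
  rw [h4, ← h1, Matrix.rank] at h3
  rw [Module.finrank_fintype_fun_eq_card, ← Nat.card_eq_fintype_card] at h2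
  rw [h5]
  omega

lemma real_spectralDistribution_zero :
    t.spectralDistribution.real {0} = (Module.finrank ℝ (nullSpace t.graph) : ℝ) / t.size := by
  classical
  rw [spectralDistribution, real_inv_smul_sum_dirac _ (measurableSet_singleton 0),
    ← ncard_eigenvalues_eq_zero]
  rfl

variable {t}

lemma mem_J_iff_fringe_mem {k : ℕ} {v : Fin t.size} (h : 2 * k + 3 ≤ t.height v) :
    v ∈ J t.graph k ↔ t.fringe v ∈ rootInJ k := by
  obtain ⟨φ, hφ, hloc⟩ := exists_localIso_fringe v
  rw [rootInJ, Set.mem_ofPred_eq, mem_J_iff_of_localIso k (hloc.mono h), hφ]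

lemma mem_H_iff_fringe_mem {k : ℕ} {v : Fin t.size} (h : 2 * k + 3 ≤ t.height v) :
    v ∈ H t.graph k ↔ t.fringe v ∈ rootInH k := by
  obtain ⟨φ, hφ, hloc⟩ := exists_localIso_fringe v
  rw [rootInH, Set.mem_ofPred_eq, mem_H_iff_of_localIso k (hloc.mono h), hφ]

lemma abs_ncard_sub_ncard_le {α : Type*} [Finite α] {S S' B : Set α}
    (h : ∀ v ∉ B, (v ∈ S ↔ v ∈ S')) : |(S.ncard : ℝ) - S'.ncard| ≤ B.ncard := by
  have key : ∀ S S' : Set α, (∀ v ∉ B, v ∈ S → v ∈ S') → (S.ncard : ℝ) ≤ S'.ncard + B.ncard := by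
    intro S S' h
    have h1 : S ⊆ S' ∪ B := fun v hv => by
      by_cases hB : v ∈ B
      · exact Or.inr hB
      · exact Or.inl (h v hB hv)
    exact_mod_cast (Set.ncard_le_ncard h1).trans (Set.ncard_union_le _ _)
  have h1 := key S S' fun v hv => (h v hv).1
  have h2 := key S' S fun v hv => (h v hv).2
  rw [abs_le]
  constructor <;> linarith

lemma abs_ncard_div_sub_le {S : Set (Fin t.size)} {A B : Set (ℕ → UTreeStar)} (hA : IsClopen A)
    (hB : IsClopen B) (h : ∀ v, t.fringe v ∉ B → (v ∈ S ↔ t.fringe v ∈ A)) :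
    |(S.ncard : ℝ) / t.size - (t.fringeLaw : Measure (ℕ → UTreeStar)).real A| ≤
      (t.fringeLaw : Measure (ℕ → UTreeStar)).real B := by
  rw [real_fringeLaw t hA, real_fringeLaw t hB, ← sub_div, abs_div, Nat.abs_cast]
  gcongr
  exact abs_ncard_sub_ncard_le h

lemma ncard_div_le {S : Set (Fin t.size)} {B : Set (ℕ → UTreeStar)}
    (hB : IsClopen B) (h : ∀ v ∈ S, t.fringe v ∈ B) :
    (S.ncard : ℝ) / t.size ≤ (t.fringeLaw : Measure (ℕ → UTreeStar)).real B := by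
  rw [real_fringeLaw t hB]
  gcongr
  · exact Set.toFinite _
  · exact h

/-- The mass at zero of the spectral distribution is approximated by the fringe law. -/
lemma abs_real_spectralDistribution_zero_sub_le (t : LTree) (m : ℕ) :
    |t.spectralDistribution.real {0} - ∑ k ∈ Finset.range m,
      ((t.fringeLaw : Measure (ℕ → UTreeStar)).real (rootInJ k) -
        (t.fringeLaw : Measure (ℕ → UTreeStar)).real (rootInH k))| ≤
      (t.fringeLaw : Measure (ℕ → UTreeStar)).real (starAt 1) +
      (t.fringeLaw : Measure (ℕ → UTreeStar)).real (headSizeGt m) +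
      2 * m * (t.fringeLaw : Measure (ℕ → UTreeStar)).real (starAt (2 * m + 1)) := by
  set ν := (t.fringeLaw : Measure (ℕ → UTreeStar)) with hν
  have hI0 : ((I t.graph 0).ncard : ℝ) / t.size ≤ ν.real (starAt 1) := by
    refine ncard_div_le (isClopen_starAt 1) fun v hv => ?_
    refine (fringe_eq_none_iff v 1).2 ?_
    by_contra hcon
    -- A vertex other than the root has a parent, so only the root can be isolated.
    have := (isChild_ancestor v (k := 0) (by omega)).1
    rw [ancestor_zero] at this
    exact hv _ this
  have hIm : ((I t.graph m)ᶜ.ncard : ℝ) / t.size ≤ ν.real (headSizeGt m) := by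
    refine ncard_div_le (isClopen_headSizeGt m) fun v hv => ?_
    rw [headSizeGt, Set.mem_ofPred_eq, size_fringe_zero]
    by_contra hcon
    exact hv (mem_I_of_ncard_fringeSet_le m (not_lt.1 hcon))
  -- For k < m the radius 2k + 3 is at most 2m + 1, so one exceptional event serves all terms.
  have hheight : ∀ v, t.fringe v ∉ starAt (2 * m + 1) → 2 * m + 1 ≤ t.height v := fun v hv =>
    not_lt.1 fun h => hv ((fringe_eq_none_iff v _).2 h)
  have hterm : ∀ k ∈ Finset.range m,
      |(((J t.graph k).ncard : ℝ) / t.size - (H t.graph k).ncard / t.size) -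
        (ν.real (rootInJ k) - ν.real (rootInH k))| ≤ 2 * ν.real (starAt (2 * m + 1)) := by
    intro k hk
    rw [Finset.mem_range] at hk
    have h1 := abs_ncard_div_sub_le (t := t) (isClopen_rootInJ k) (isClopen_starAt (2 * m + 1))
      fun v hv => mem_J_iff_fringe_mem (by have := hheight v hv; omega)
    have h2 := abs_ncard_div_sub_le (t := t) (isClopen_rootInH k) (isClopen_starAt (2 * m + 1))
      fun v hv => mem_H_iff_fringe_mem (by have := hheight v hv; omega)
    rw [sub_sub_sub_comm, two_mul]
    exact (abs_sub _ _).trans (add_le_add h1 h2)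
  have hmain : |t.spectralDistribution.real {0} -
      ∑ k ∈ Finset.range m, (((J t.graph k).ncard : ℝ) / t.size - (H t.graph k).ncard / t.size)| ≤
      (I t.graph 0).ncard / t.size + (I t.graph m)ᶜ.ncard / t.size := by
    simp_rw [real_spectralDistribution_zero, ← sub_div, ← Finset.sum_div]
    rw [← sub_div, ← add_div, abs_div, Nat.abs_cast]
    gcongr
    exact abs_finrank_nullSpace_sub_le t.graph m
  have hsum := (Finset.abs_sum_le_sum_abs _ _).trans (Finset.sum_le_sum hterm)
  rw [Finset.sum_sub_distrib, Finset.sum_const, Finset.card_range, nsmul_eq_mul] at hsum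
  calc _ ≤ _ := abs_sub_le _ (∑ k ∈ Finset.range m,
          (((J t.graph k).ncard : ℝ) / t.size - (H t.graph k).ncard / t.size)) _
    _ ≤ _ := by linarith

end LTree

/-! ### Convergence -/

/-- Evaluation of probability measures at a clopen set. -/
noncomputable def evalClopen (A : Set (ℕ → UTreeStar)) (hA : IsClopen A) :
    ProbabilityMeasure (ℕ → UTreeStar) →ᵇ ℝ :=
  BoundedContinuousFunction.ofNormedAddCommGroup
    (fun ν => (ν : Measure (ℕ → UTreeStar)).real A)
    (continuous_iff_continuousAt.2 fun _ => (NNReal.continuous_coe.tendsto _).comp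
      (ProbabilityMeasure.tendsto_measure_of_isClopen_of_tendsto tendsto_id hA)) 1
    fun ν => by
      rw [Real.norm_of_nonneg measureReal_nonneg]
      exact measureReal_le_one

/-- A bounded continuous functional that controls the distance between `c` and the mass at zero of
the spectral distribution. -/
noncomputable def errorFunctional (c : ℝ) (m : ℕ) : ProbabilityMeasure (ℕ → UTreeStar) →ᵇ ℝ :=
  (∑ k ∈ Finset.range m, (evalClopen (rootInJ k) (isClopen_rootInJ k) -
      evalClopen (rootInH k) (isClopen_rootInH k)) - BoundedContinuousFunction.const _ c).normComp +
    (evalClopen (starAt 1) (isClopen_starAt 1) +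
      evalClopen (headSizeGt m) (isClopen_headSizeGt m) +
      (2 * m : ℝ) • evalClopen (starAt (2 * m + 1)) (isClopen_starAt (2 * m + 1)))

lemma errorFunctional_apply (c : ℝ) (m : ℕ) (ν : ProbabilityMeasure (ℕ → UTreeStar)) :
    errorFunctional c m ν =
      |∑ k ∈ Finset.range m, ((ν : Measure (ℕ → UTreeStar)).real (rootInJ k) -
          (ν : Measure (ℕ → UTreeStar)).real (rootInH k)) - c| +
        ((ν : Measure (ℕ → UTreeStar)).real (starAt 1) +
        (ν : Measure (ℕ → UTreeStar)).real (headSizeGt m) +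
        2 * m * (ν : Measure (ℕ → UTreeStar)).real (starAt (2 * m + 1))) := by
  simp [errorFunctional, evalClopen]

lemma abs_spectralDistribution_sub_le (t : UTree) (c : ℝ) (m : ℕ) :
    |t.spectralDistribution.real {0} - c| ≤ errorFunctional c m t.fringeLaw := by
  rw [errorFunctional_apply]
  refine (abs_sub_le _ (∑ k ∈ Finset.range m,
    ((t.fringeLaw : Measure (ℕ → UTreeStar)).real (rootInJ k) -
      (t.fringeLaw : Measure (ℕ → UTreeStar)).real (rootInH k))) _).trans ?_
  have h := t.rep.abs_real_spectralDistribution_zero_sub_le m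
  change |t.spectralDistribution.real {0} - _| ≤ _ at h
  rw [add_comm |_|]
  exact add_le_add le_rfl h

/-! ### The limit law. -/

section SinTreeLaw

variable {Ω' : Type*} [MeasurableSpace Ω'] (P : Measure Ω') [IsProbabilityMeasure P]
  {τ : Ω' → ℕ → UTree} (hτ : Measurable τ)

lemma real_sinTreeLaw {A : Set (ℕ → UTreeStar)} (hA : IsClopen A) :
    (sinTreeLaw P hτ : Measure (ℕ → UTreeStar)).real A =
      P.real {ω | (fun k => some (τ ω k)) ∈ A} := by
  have hm : Measurable fun ω k => (some (τ ω k) : UTreeStar) :=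
    measurable_pi_lambda _ fun k => (Measurable.of_discrete (f := (some : UTree → UTreeStar))).comp
      ((measurable_pi_apply k).comp hτ)
  exact map_measureReal_apply hm hA.isOpen.measurableSet

/-- No adjoined point occurs, so `fillSeq` returns `τ ω` by definition. -/
lemma real_sinTreeLaw_rootInJ (k : ℕ) :
    (sinTreeLaw P hτ : Measure (ℕ → UTreeStar)).real (rootInJ k) =
      P.real {ω | sinRoot (τ ω) ∈ J (sinTree (τ ω)) k} :=
  real_sinTreeLaw P hτ (isClopen_rootInJ k)

lemma real_sinTreeLaw_rootInH (k : ℕ) :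
    (sinTreeLaw P hτ : Measure (ℕ → UTreeStar)).real (rootInH k) =
      P.real {ω | sinRoot (τ ω) ∈ H (sinTree (τ ω)) k} :=
  real_sinTreeLaw P hτ (isClopen_rootInH k)

lemma real_sinTreeLaw_starAt (k : ℕ) :
    (sinTreeLaw P hτ : Measure (ℕ → UTreeStar)).real (starAt k) = 0 := by
  rw [real_sinTreeLaw P hτ (isClopen_starAt k)]
  simp [starAt]

/-- Continuity from above: the first tree is finite, so these events decrease to the empty set. -/
lemma tendsto_real_headSizeGt (ν : Measure (ℕ → UTreeStar)) [IsFiniteMeasure ν] :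
    Tendsto (fun m => ν.real (headSizeGt m)) atTop (𝓝 0) := by
  have h := tendsto_measure_iInter_atTop (μ := ν) (s := headSizeGt)
    (fun m => (isClopen_headSizeGt m).isOpen.measurableSet.nullMeasurableSet)
    (fun m n hmn x hx => lt_of_le_of_lt hmn hx) ⟨0, measure_ne_top _ _⟩
  have hempty : ⋂ m, headSizeGt m = ∅ :=
    Set.eq_empty_of_forall_notMem fun x hx =>
      lt_irrefl (fillSeq x 0).rep.size (Set.mem_iInter.1 hx (fillSeq x 0).rep.size)
  rw [hempty, measure_empty] at h
  exact (ENNReal.tendsto_toReal ENNReal.zero_ne_top).comp h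

lemma summable_real_rootInJ_sub_rootInH (ν : Measure (ℕ → UTreeStar)) [IsFiniteMeasure ν] :
    Summable fun k => ν.real (rootInJ k) - ν.real (rootInH k) := by
  refine (summable_measure_toReal (fun k => (isClopen_rootInJ k).isOpen.measurableSet) ?_).sub
    (summable_measure_toReal (fun k => (isClopen_rootInH k).isOpen.measurableSet) ?_)
  · exact fun i j hij => Set.disjoint_left.2 fun x hi hj =>
      Set.disjoint_left.1 (pairwise_disjoint_J _ hij) hi hj
  · exact fun i j hij => Set.disjoint_left.2 fun x hi hj =>
      Set.disjoint_left.1 (pairwise_disjoint_H _ hij) hi hj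

lemma tendsto_errorFunctional_sinTreeLaw :
    Tendsto (fun m => errorFunctional (∑' k,
      ((sinTreeLaw P hτ : Measure (ℕ → UTreeStar)).real (rootInJ k) -
        (sinTreeLaw P hτ : Measure (ℕ → UTreeStar)).real (rootInH k))) m (sinTreeLaw P hτ))
      atTop (𝓝 0) := by
  have h1 := (summable_real_rootInJ_sub_rootInH
    (sinTreeLaw P hτ : Measure (ℕ → UTreeStar))).hasSum.tendsto_sum_nat
  have h2 := tendsto_real_headSizeGt (sinTreeLaw P hτ : Measure (ℕ → UTreeStar))
  simp only [errorFunctional_apply, real_sinTreeLaw_starAt, zero_add, mul_zero, add_zero]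
  have h3 := (h1.sub_const (∑' k, ((sinTreeLaw P hτ : Measure (ℕ → UTreeStar)).real (rootInJ k) -
    (sinTreeLaw P hτ : Measure (ℕ → UTreeStar)).real (rootInH k)))).abs.add h2
  rwa [sub_self, abs_zero, add_zero] at h3

end SinTreeLaw

/-- Bounded Lipschitz test functions suffice, and for one with constant K the expectations differ by
at most K times the L¹ distance to c. -/
lemma tendstoInDistribution_const_of_tendsto_integral_abs_sub {Ω : ℕ → Type*}
    [∀ n, MeasurableSpace (Ω n)] (μ : ∀ n, Measure (Ω n)) [∀ n, IsProbabilityMeasure (μ n)]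
    {Ω' : Type*} [MeasurableSpace Ω'] (P : Measure Ω') [IsProbabilityMeasure P]
    {X : ∀ n, Ω n → ℝ} (hX : ∀ n, Measurable (X n)) {c : ℝ}
    (hint : ∀ n, Integrable (fun ω => |X n ω - c|) (μ n))
    (hlim : Tendsto (fun n => ∫ ω, |X n ω - c| ∂(μ n)) atTop (𝓝 0)) :
    TendstoInDistribution X atTop (fun _ : Ω' => c) μ P where
  forall_aemeasurable n := (hX n).aemeasurable
  aemeasurable_limit := aemeasurable_const
  tendsto := by
    refine tendsto_iff_forall_lipschitz_integral_tendsto.2 ?_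
    rintro f ⟨C, hC⟩ ⟨K, hK⟩
    have hf : Measurable f := hK.continuous.measurable
    simp only [ProbabilityMeasure.coe_mk]
    rw [integral_map aemeasurable_const hf.aestronglyMeasurable]
    simp_rw [integral_map (hX _).aemeasurable hf.aestronglyMeasurable]
    rw [integral_const, probReal_univ, one_smul, tendsto_iff_norm_sub_tendsto_zero]
    refine squeeze_zero (fun _ => norm_nonneg _) (fun n => ?_)
      (by simpa using hlim.const_mul (K : ℝ))
    have hfint : Integrable (fun ω => f (X n ω)) (μ n) := by
      refine Integrable.of_bound (hf.comp (hX n)).aestronglyMeasurable (C + ‖f 0‖)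
        (ae_of_all _ fun ω => ?_)
      have := hC (X n ω) 0
      rw [dist_eq_norm] at this
      calc ‖f (X n ω)‖ = ‖(f (X n ω) - f 0) + f 0‖ := by rw [sub_add_cancel]
        _ ≤ _ := norm_add_le _ _
        _ ≤ _ := by gcongr
    have hsub : ∫ ω, f (X n ω) ∂(μ n) - f c = ∫ ω, (f (X n ω) - f c) ∂(μ n) := by
      rw [integral_sub hfint (integrable_const _), integral_const, probReal_univ, one_smul]
    rw [hsub, ← integral_const_mul]
    refine (norm_integral_le_integral_norm _).trans
      (integral_mono (hfint.sub (integrable_const _)).norm ((hint n).const_mul _) fun ω => ?_)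
    have := hK.dist_le_mul (X n ω) c
    rwa [dist_eq_norm, Real.dist_eq] at this

end FringeTrees

open FringeTrees

theorem proposition6p4
    {Ω : ℕ → Type*} [∀ n, MeasurableSpace (Ω n)]
    (μ : ∀ n, Measure (Ω n)) [∀ n, IsProbabilityMeasure (μ n)]
    (T : ∀ n, Ω n → UTree) (hT : ∀ n, Measurable (T n))
    {Ω' : Type*} [MeasurableSpace Ω'] (P : Measure Ω') [IsProbabilityMeasure P]
    (τ : Ω' → ℕ → UTree) (hτ : Measurable τ)
    (hconv : FringeConverges μ T P hτ) :
    Summable (fun k : ℕ =>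
      P.real {ω | sinRoot (τ ω) ∈ KarpSipser.J (sinTree (τ ω)) k} -
        P.real {ω | sinRoot (τ ω) ∈ KarpSipser.H (sinTree (τ ω)) k}) ∧
    TendstoInDistribution
      (fun n ω => (T n ω).spectralDistribution.real {0}) atTop
      (fun _ : Ω' => ∑' k : ℕ,
        (P.real {ω | sinRoot (τ ω) ∈ KarpSipser.J (sinTree (τ ω)) k} -
          P.real {ω | sinRoot (τ ω) ∈ KarpSipser.H (sinTree (τ ω)) k}))
      μ P := by
  simp_rw [← real_sinTreeLaw_rootInJ P hτ, ← real_sinTreeLaw_rootInH P hτ]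
  refine ⟨summable_real_rootInJ_sub_rootInH _, ?_⟩
  set c := ∑' k, ((sinTreeLaw P hτ : Measure (ℕ → UTreeStar)).real (rootInJ k) -
    (sinTreeLaw P hτ : Measure (ℕ → UTreeStar)).real (rootInH k))
  have hX : ∀ n, Measurable fun ω => (T n ω).spectralDistribution.real {0} := fun n =>
    (Measurable.of_discrete (f := fun t : UTree => t.spectralDistribution.real {0})).comp (hT n)
  -- Measurability is free because the integrand factors through the discrete space `UTree`.
  have hgint : ∀ m n, Integrable (fun ω => errorFunctional c m (T n ω).fringeLaw) (μ n) :=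
    fun m n => Integrable.of_bound ((Measurable.of_discrete
      (f := fun t : UTree => errorFunctional c m t.fringeLaw)).comp (hT n)).aestronglyMeasurable
      ‖errorFunctional c m‖ (ae_of_all _ fun ω => (errorFunctional c m).norm_coe_le_norm _)
  have hint : ∀ n, Integrable (fun ω => |(T n ω).spectralDistribution.real {0} - c|) (μ n) :=
    fun n => (hgint 0 n).mono' ((hX n).sub_const c).abs.aestronglyMeasurable
      (ae_of_all _ fun ω => by
        rw [Real.norm_eq_abs, abs_abs]
        exact abs_spectralDistribution_sub_le _ c 0)
  refine tendstoInDistribution_const_of_tendsto_integral_abs_sub μ P hX hint ?_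
  refine (tendsto_order.2 ⟨fun a ha => Eventually.of_forall fun n =>
    ha.trans_le (integral_nonneg fun ω => abs_nonneg _), fun a ha => ?_⟩)
  -- The order of limits matters: `m` is fixed by the limit law first, and only then does fringe
  -- convergence apply, to a single continuous functional.
  obtain ⟨m, hm⟩ := ((tendsto_errorFunctional_sinTreeLaw P hτ).eventually_lt_const ha).exists
  filter_upwards [(hconv (errorFunctional c m)).eventually_lt_const hm] with n hn
  exact (integral_mono (hint n) (hgint m n) fun ω =>
    abs_spectralDistribution_sub_le _ c m).trans_lt hn
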